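/- Let $(\mathbb{X},\mathcal{X})$ be a measurable space and let $\pi$ and $q$ be probability measures on it with $\pi\ll q$. Let $\omega=d\pi/dq$ (so that $q(\omega)=\int\omega\,dq=1$), and assume that $\omega>0$ $q$-almost surely. Let $f:\mathbb{X}\to\mathbb{R}$ be measurable with $|f|\le 1$ ($q$-almost everywhere is enough). Let $p\ge 2$ and $1\le s<p$ be real numbers, and assume that $q(\omega^p)=\int\omega^p\,dq<\infty$. Fix an integer $N\ge 1$, let $\bar q=q^{\otimes N}$, and for $\mathbf{x}=(x_1,\dots,x_N)\in\mathbb{X}^N$ put $$\hat Z(\mathbf{x})=\frac1N\sum_{n=1}^N\omega(x_n),\qquad \hat F(\mathbf{x})=\frac{\sum_{n=1}^N\omega(x_n)f(x_n)}{\sum_{n=1}^N\omega(x_n)}.$$ Consider the following coupled particle independent Metropolis--Hastings chains with a lag. Draw $\mathbf{x}_0,\mathbf{y}_0\sim\bar q$, common proposals $\mathbf{x}^\star_2,\mathbf{x}^\star_3,\ldots\sim\bar q$ and $u_1,u_2,\ldots\sim\mathrm{Uniform}(0,1)$, all mutually independent. If $u_1<\hat Z(\mathbf{y}_0)/\hat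 Z(\mathbf{x}_0)$ set $\mathbf{x}_1=\mathbf{y}_0$, otherwise set $\mathbf{x}_1=\mathbf{x}_0$. For $t\ge 1$, set $\mathbf{x}_{t+1}=\mathbf{x}^\star_{t+1}$ if $u_{t+1}<\hat Z(\mathbf{x}^\star_{t+1})/\hat Z(\mathbf{x}_t)$ and $\mathbf{x}_{t+1}=\mathbf{x}_t$ otherwise; and set $\mathbf{y}_{t}=\mathbf{x}^\star_{t+1}$ if $u_{t+1}<\hat Z(\mathbf{x}^\star_{t+1})/\hat Z(\mathbf{y}_{t-1})$ and $\mathbf{y}_{t}=\mathbf{y}_{t-1}$ otherwise. Let $$\tau=\inf\{t\ge1:\mathbf{x}_t=\mathbf{y}_{t-1}\}\in\mathbb{N}\cup\{\infty\},\qquad \hat F_u=\hat F(\mathbf{x}_0)+\sum_{t=1}^{\tau-1}\bigl\{\hat F(\mathbf{x}_t)-\hat F(\mathbf{y}_{t-1})\bigr\}.$$ Then the meeting time $\tau$ and the unbiased self-normalized importance sampling estimator $\hat F_u$ have finite $s$-th moments: $$\mathbb{E}[\tau^s]<\infty\qquad\text{and}\qquad \mathbb{E}\bigl[|\hat F_u|^s\bigr]<\infty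 .$$ (In particular $\tau<\infty$ almost surely, so that $\hat F_u$ is almost surely well defined.) -/

import Mathlib

open MeasureTheory ProbabilityTheory
open scoped ENNReal

noncomputable section

namespace PIMH

variable {X : Type*} {N : ℕ}

/-- The average weight `Ẑ(x₁, …, x_N) = N⁻¹ ∑ₙ w(xₙ)`. -/
def Zhat (w : X → ℝ) (x : Fin N → X) : ℝ :=
  (N : ℝ)⁻¹ * ∑ n, w (x n)

/-- The self-normalized importance sampling estimator
`F̂(x₁, …, x_N) = ∑ₙ w(xₙ) f(xₙ) / ∑ₙ w(xₙ)`. -/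
def Fhat (w f : X → ℝ) (x : Fin N → X) : ℝ :=
  (∑ n, w (x n) * f (x n)) / ∑ n, w (x n)

/-- One step of particle independent Metropolis–Hastings from the state `x`, with proposal `xs` and
uniform draw `u`: the proposal is accepted when `u < Ẑ(xs) / Ẑ(x)`. -/
def step (w : X → ℝ) (x xs : Fin N → X) (u : ℝ) : Fin N → X :=
  if u < Zhat w xs / Zhat w x then xs else x

/-- One step of the common draws coupling: both chains use the same proposal and uniform. -/
def coupledStep (w : X → ℝ) (z : (Fin N → X) × (Fin N → X)) (xs : Fin N → X) (u : ℝ) :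
    (Fin N → X) × (Fin N → X) :=
  (step w z.1 xs u, step w z.2 xs u)

/-- The coupled chains with a lag, as a function of the successive draws: `ξ 0` is the initial state
`x₀`, `ξ 1` is the initial state `y₀` (also the first proposal made to the `x`-chain),
`ξ 2, ξ 3, …` are the later common proposals, and `u 0, u 1, …` are the uniforms.
The value at `t` is the pair `(x_{t+1}, y_t)`. -/
def laggedPair (w : X → ℝ) (ξ : ℕ → Fin N → X) (u : ℕ → ℝ) : ℕ → (Fin N → X) × (Fin N → X)
  | 0 => (step w (ξ 0) (ξ 1) (u 0), ξ 1)
  | t + 1 => coupledStep w (laggedPair w ξ u t) (ξ (t + 2)) (u (t + 1))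

/-- The chain `(x_t)`. -/
def chainX (w : X → ℝ) (ξ : ℕ → Fin N → X) (u : ℕ → ℝ) : ℕ → Fin N → X
  | 0 => ξ 0
  | t + 1 => (laggedPair w ξ u t).1

/-- The chain `(y_t)`. -/
def chainY (w : X → ℝ) (ξ : ℕ → Fin N → X) (u : ℕ → ℝ) (t : ℕ) : Fin N → X :=
  (laggedPair w ξ u t).2

/-- The meeting time `τ = inf {t ≥ 1 : x_t = y_{t-1}}`, which is `⊤` if the chains never meet. -/
def meetingTime (w : X → ℝ) (ξ : ℕ → Fin N → X) (u : ℕ → ℝ) : ℕ∞ :=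
  sInf ((fun t : ℕ => (t : ℕ∞)) '' {t : ℕ | 1 ≤ t ∧ chainX w ξ u t = chainY w ξ u (t - 1)})

/-- The unbiased self-normalized importance sampling estimator
`F̂_u = F̂(x₀) + ∑_{t=1}^{τ-1} (F̂(x_t) - F̂(y_{t-1}))`
(with the sum read as `0` on the event `τ = ⊤`). -/
def unbiasedIS (w f : X → ℝ) (ξ : ℕ → Fin N → X) (u : ℕ → ℝ) : ℝ :=
  Fhat w f (ξ 0) + ∑ t ∈ Finset.Ico 1 (meetingTime w ξ u).toNat,
    (Fhat w f (chainX w ξ u t) - Fhat w f (chainY w ξ u (t - 1)))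

/-- The random draws consumed by the lagged coupling with `N` particles: the `ξ t` have law
`q̄ = q ⊗ ⋯ ⊗ q`, the `U t` are uniform on `(0,1)`, and all of them are mutually independent. -/
structure IsInput {Ω : Type*} [MeasurableSpace X] [MeasurableSpace Ω] (q : Measure X)
    (P : Measure Ω) (ξ : ℕ → Ω → Fin N → X) (U : ℕ → Ω → ℝ) : Prop where
  measurable_draw : ∀ t, Measurable (ξ t)
  measurable_unif : ∀ t, Measurable (U t)
  law_draw : ∀ t, P.map (ξ t) = Measure.pi fun _ : Fin N => q
  law_unif : ∀ t, P.map (U t) = volume.restrict (Set.Ioo (0 : ℝ) 1)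
  indep_draw : iIndepFun ξ P
  indep_unif : iIndepFun U P
  indep_draw_unif : IndepFun (fun ω t => ξ t ω) (fun ω t => U t ω) P

end PIMH

end

namespace PIMH

variable {X : Type*} {N : ℕ}

/-! The coupling is monotone. As long as the lagging-free chain `chainX` has rejected everything, it
sits at `ξ 0`, while `chainY` only visits proposals that were rejected against `ξ 0` and hence have
smaller `Zhat`. The acceptance ratio of `chainY` is then the larger one, so the first proposal
accepted by `chainX` is accepted by both, and the chains meet (`laggedPair_dichotomy`). Thus almost
surely `t < τ` means exactly that the first `t` proposals are rejected against `ξ 0`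
(`lt_meetingTime_iff`). Given `ξ 0 = x` these trials are i.i.d., so P(τ > t) = ∫ ρ(x)^t dq̄(x), with
ρ the rejection probability (`measure_forall_reject`). Since ρ(x) ≤ exp(-c / max(1, Ẑ(x))) and Ẑ
inherits a finite p-th moment from `w`, the inequality e^{-y} ≤ (p/y)^p gives P(τ > t) = O(t^{-p})
(`exists_lintegral_reject_pow_le`). The layer-cake sum of t^{s-1} P(τ > t) converges because s < p.
Finally |F̂| ≤ 1 gives |F̂_u| ≤ 2τ. -/

/-! ### Pathwise analysis of the coupling. -/

lemma Zhat_pos {w : X → ℝ} (hN : 1 ≤ N) {x : Fin N → X} (hx : ∀ n, 0 < w (x n)) :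
    0 < Zhat w x := by
  have : Nonempty (Fin N) := ⟨⟨0, hN⟩⟩
  have h : (0 : ℝ) < N := by exact_mod_cast hN
  exact mul_pos (inv_pos.2 h) (Finset.sum_pos (fun n _ => hx n) Finset.univ_nonempty)

lemma abs_Fhat_le_one {w f : X → ℝ} {x : Fin N → X} (hx : ∀ n, 0 < w (x n))
    (hf : ∀ n, |f (x n)| ≤ 1) : |Fhat w f x| ≤ 1 := by
  have hs : 0 ≤ ∑ n, w (x n) := Finset.sum_nonneg fun n _ => (hx n).le
  rw [Fhat, abs_div, abs_of_nonneg hs]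
  refine div_le_one_of_le₀ ((Finset.abs_sum_le_sum_abs _ _).trans ?_) hs
  refine Finset.sum_le_sum fun n _ => ?_
  rw [abs_mul, abs_of_pos (hx n)]
  exact mul_le_of_le_one_right (hx n).le (hf n)

/-- The first chain, started from `ξ 0`, would accept the proposal `ξ (k + 1)`. -/
def Accepts (w : X → ℝ) (ξ : ℕ → Fin N → X) (u : ℕ → ℝ) (k : ℕ) : Prop :=
  u k < Zhat w (ξ (k + 1)) / Zhat w (ξ 0)

lemma step_mem {w : X → ℝ} {S : Set (Fin N → X)} {x xs : Fin N → X} (hx : x ∈ S) (hxs : xs ∈ S)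
    (u : ℝ) : step w x xs u ∈ S := by
  rw [step]; split_ifs <;> assumption

lemma laggedPair_mem {w : X → ℝ} {ξ : ℕ → Fin N → X} {S : Set (Fin N → X)} (h : ∀ t, ξ t ∈ S)
    (u : ℕ → ℝ) (t : ℕ) :
    (laggedPair w ξ u t).1 ∈ S ∧ (laggedPair w ξ u t).2 ∈ S := by
  induction t with
  | zero => exact ⟨step_mem (h 0) (h 1) _, h 1⟩
  | succ t ih => exact ⟨step_mem ih.1 (h _) _, step_mem ih.2 (h _) _⟩

lemma chainX_mem {w : X → ℝ} {ξ : ℕ → Fin N → X} {S : Set (Fin N → X)} (h : ∀ t, ξ t ∈ S)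
    (u : ℕ → ℝ) (t : ℕ) : chainX w ξ u t ∈ S := by
  cases t with
  | zero => exact h 0
  | succ t => exact (laggedPair_mem h u t).1

/-- Until the first chain accepts a proposal it stays at `ξ 0` and the second chain has a strictly
smaller weight; from the first acceptance on, the two chains agree. -/
lemma laggedPair_dichotomy {w : X → ℝ} {ξ : ℕ → Fin N → X} {u : ℕ → ℝ}
    (hZ : ∀ t, 0 < Zhat w (ξ t)) (hu : ∀ t, u t < 1) (t : ℕ) :
    ((∃ k < t + 1, Accepts w ξ u k) ∧ (laggedPair w ξ u t).1 = (laggedPair w ξ u t).2) ∨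
    ((∀ k < t + 1, ¬ Accepts w ξ u k) ∧ (laggedPair w ξ u t).1 = ξ 0 ∧
      Zhat w (laggedPair w ξ u t).2 < Zhat w (ξ 0)) := by
  have reject (k : ℕ) (h : ¬ Accepts w ξ u k) : Zhat w (ξ (k + 1)) < Zhat w (ξ 0) := by
    rw [Accepts, not_lt] at h
    exact (div_lt_one (hZ 0)).1 (h.trans_lt (hu k))
  induction t with
  | zero =>
    by_cases h : Accepts w ξ u 0
    · exact .inl ⟨⟨0, by simp, h⟩, by rw [Accepts] at h; simp_all [laggedPair, step]⟩
    · refine .inr ⟨fun k hk => by obtain rfl : k = 0 := by omega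
                                  exact h, ?_, reject 0 h⟩
      rw [Accepts] at h; simp_all [laggedPair, step]
  | succ t ih =>
    rcases ih with ⟨⟨k, hk, hA⟩, he⟩ | ⟨hA, h1, h2⟩
    · exact .inl ⟨⟨k, by omega, hA⟩, by simp [laggedPair, coupledStep, he]⟩
    · have hy : 0 < Zhat w (laggedPair w ξ u t).2 :=
        (laggedPair_mem (S := {x | 0 < Zhat w x}) hZ u t).2
      by_cases h : Accepts w ξ u (t + 1)
      · refine .inl ⟨⟨t + 1, by omega, h⟩, ?_⟩
        have h' : u (t + 1) < Zhat w (ξ (t + 2)) / Zhat w (ξ 0) := h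
        have h'' : u (t + 1) < Zhat w (ξ (t + 2)) / Zhat w (laggedPair w ξ u t).2 :=
          -- The lighter current state has the larger acceptance ratio, so the second chain accepts
          -- too.
          h'.trans (div_lt_div_of_pos_left (hZ _) hy h2)
        simp [laggedPair, coupledStep, step, h1, h', h'']
      · refine .inr ⟨fun k hk => ?_, ?_, ?_⟩
        · rcases Nat.lt_succ_iff_lt_or_eq.1 hk with hk | rfl
          exacts [hA k hk, h]
        · have h' : ¬ u (t + 1) < Zhat w (ξ (t + 2)) / Zhat w (ξ 0) := h
          simp [laggedPair, coupledStep, step, h1, h']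
        · exact step_mem (S := {x | Zhat w x < Zhat w (ξ 0)}) h2 (reject _ h) _

lemma chainX_eq_chainY_iff {w : X → ℝ} {ξ : ℕ → Fin N → X} {u : ℕ → ℝ}
    (hZ : ∀ t, 0 < Zhat w (ξ t)) (hu : ∀ t, u t < 1) (t : ℕ) (ht : 1 ≤ t) :
    chainX w ξ u t = chainY w ξ u (t - 1) ↔ ∃ k < t, Accepts w ξ u k := by
  obtain ⟨t, rfl⟩ := Nat.exists_eq_add_of_le' ht
  rw [Nat.add_sub_cancel]
  change (laggedPair w ξ u t).1 = (laggedPair w ξ u t).2 ↔ _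
  rcases laggedPair_dichotomy hZ hu t with ⟨h, h'⟩ | ⟨h, h1, h2⟩
  · simp only [h, h']
  · refine iff_of_false (fun he => ?_) (by push Not; exact h)
    rw [← he, h1] at h2
    exact lt_irrefl _ h2

lemma lt_meetingTime_iff {w : X → ℝ} {ξ : ℕ → Fin N → X} {u : ℕ → ℝ}
    (hZ : ∀ t, 0 < Zhat w (ξ t)) (hu : ∀ t, u t < 1) (t : ℕ) :
    (t : ℕ∞) < meetingTime w ξ u ↔ ∀ k < t, ¬ Accepts w ξ u k := by
  constructor
  · intro h k hk hA
    refine h.not_ge (sInf_le ⟨t, ⟨by omega, ?_⟩, rfl⟩)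
    exact (chainX_eq_chainY_iff hZ hu t (by omega)).2 ⟨k, hk, hA⟩
  · intro h
    refine (ENat.add_one_le_iff (ENat.natCast_ne_top t)).1 (le_sInf ?_)
    rintro _ ⟨n, ⟨hn, he⟩, rfl⟩
    obtain ⟨k, hk, hA⟩ := (chainX_eq_chainY_iff hZ hu n hn).1 he
    have : t ≤ k := not_lt.1 fun hkt => h k hkt hA
    change ((t : ℕ∞) + 1) ≤ n
    exact_mod_cast (show t + 1 ≤ n by omega)

lemma one_le_meetingTime (w : X → ℝ) (ξ : ℕ → Fin N → X) (u : ℕ → ℝ) :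
    1 ≤ meetingTime w ξ u :=
  le_sInf fun _ ⟨_, h, he⟩ => he ▸ Nat.one_le_cast.2 h.1

lemma chainX_eq_chainY_of_meetingTime_le {w : X → ℝ} {ξ : ℕ → Fin N → X} {u : ℕ → ℝ}
    (hZ : ∀ t, 0 < Zhat w (ξ t)) (hu : ∀ t, u t < 1) {t : ℕ} (ht : meetingTime w ξ u ≤ t) :
    chainX w ξ u t = chainY w ξ u (t - 1) := by
  have h1 : 1 ≤ t := by exact_mod_cast (one_le_meetingTime w ξ u).trans ht
  rw [chainX_eq_chainY_iff hZ hu t h1]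
  by_contra! h
  exact ((lt_meetingTime_iff hZ hu t).2 h).not_ge ht

lemma abs_unbiasedIS_le {w f : X → ℝ} {ξ : ℕ → Fin N → X} {u : ℕ → ℝ}
    (hw : ∀ t n, 0 < w (ξ t n)) (hf : ∀ t n, |f (ξ t n)| ≤ 1) (hτ : meetingTime w ξ u ≠ ⊤) :
    |unbiasedIS w f ξ u| ≤ 2 * (meetingTime w ξ u).toNat := by
  have hmem : ∀ t, ξ t ∈ {x : Fin N → X | |Fhat w f x| ≤ 1} :=
    fun t => abs_Fhat_le_one (hw t) (hf t)
  have h1 : 1 ≤ (meetingTime w ξ u).toNat := by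
    have := one_le_meetingTime w ξ u
    rw [← ENat.natCast_toNat hτ] at this
    exact_mod_cast this
  have hterm (t : ℕ) : |Fhat w f (chainX w ξ u t) - Fhat w f (chainY w ξ u (t - 1))| ≤ 2 := by
    have hX : |Fhat w f (chainX w ξ u t)| ≤ 1 := chainX_mem hmem u t
    have hY : |Fhat w f (chainY w ξ u (t - 1))| ≤ 1 := (laggedPair_mem hmem u (t - 1)).2
    exact (abs_sub _ _).trans (by linarith)
  -- One initial term of size at most 1 and τ - 1 corrections of size at most 2 give 2τ - 1.
  calc |unbiasedIS w f ξ u| ≤ 1 + ∑ t ∈ Finset.Ico 1 (meetingTime w ξ u).toNat, (2 : ℝ) :=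
        (abs_add_le _ _).trans (add_le_add (hmem 0)
          ((Finset.abs_sum_le_sum_abs _ _).trans (Finset.sum_le_sum fun t _ => hterm t)))
    _ ≤ _ := by
        rw [Finset.sum_const, Nat.card_Ico, nsmul_eq_mul, Nat.cast_sub h1]
        push_cast; linarith

/-- Corrections vanish after meeting, so sums of deterministic length are eventually constant; this
yields measurability of the sum with random range. -/
lemma tendsto_unbiasedIS {w : X → ℝ} (f : X → ℝ) {ξ : ℕ → Fin N → X} {u : ℕ → ℝ}
    (hZ : ∀ t, 0 < Zhat w (ξ t)) (hu : ∀ t, u t < 1) (hτ : meetingTime w ξ u ≠ ⊤) :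
    Filter.Tendsto (fun m : ℕ => Fhat w f (ξ 0) + ∑ t ∈ Finset.Ico 1 m,
      (Fhat w f (chainX w ξ u t) - Fhat w f (chainY w ξ u (t - 1)))) Filter.atTop
      (nhds (unbiasedIS w f ξ u)) := by
  refine tendsto_atTop_of_eventually_const (i₀ := (meetingTime w ξ u).toNat) fun m hm => ?_
  rw [unbiasedIS]
  congr 1
  refine (Finset.sum_subset (Finset.Ico_subset_Ico_right hm) fun t ht ht' => ?_).symm
  simp only [Finset.mem_Ico, not_and, not_lt] at ht ht'
  rw [chainX_eq_chainY_of_meetingTime_le hZ hu, sub_self]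
  rw [← ENat.natCast_toNat hτ]
  exact_mod_cast ht' ht.1

/-! ### Measurability of the chains in the draws. -/

section Measurability

variable [MeasurableSpace X]

@[fun_prop]
lemma measurable_Zhat {w : X → ℝ} (hw : Measurable w) :
    Measurable (Zhat w : (Fin N → X) → ℝ) := by
  unfold Zhat; fun_prop

@[fun_prop]
lemma measurable_Fhat {w f : X → ℝ} (hw : Measurable w) (hf : Measurable f) :
    Measurable (Fhat w f : (Fin N → X) → ℝ) := by
  unfold Fhat; fun_prop

variable {Ω : Type*} [MeasurableSpace Ω] {w : X → ℝ}

lemma measurable_step (hw : Measurable w) {x xs : Ω → Fin N → X} {u : Ω → ℝ}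
    (hx : Measurable x) (hxs : Measurable xs) (hu : Measurable u) :
    Measurable fun ω => step w (x ω) (xs ω) (u ω) :=
  Measurable.ite (measurableSet_lt hu (by fun_prop)) hxs hx

variable {ξ : ℕ → Ω → Fin N → X} {U : ℕ → Ω → ℝ}

lemma measurable_laggedPair (hw : Measurable w) (hξ : ∀ t, Measurable (ξ t))
    (hU : ∀ t, Measurable (U t)) (t : ℕ) :
    Measurable fun ω => laggedPair w (fun t => ξ t ω) (fun t => U t ω) t := by
  induction t with
  | zero => exact (measurable_step hw (hξ 0) (hξ 1) (hU 0)).prodMk (hξ 1)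
  | succ t ih =>
    exact (measurable_step hw ih.fst (hξ _) (hU _)).prodMk (measurable_step hw ih.snd (hξ _) (hU _))

lemma measurable_chainX (hw : Measurable w) (hξ : ∀ t, Measurable (ξ t))
    (hU : ∀ t, Measurable (U t)) (t : ℕ) :
    Measurable fun ω => chainX w (fun t => ξ t ω) (fun t => U t ω) t := by
  cases t with
  | zero => exact hξ 0
  | succ t => exact (measurable_laggedPair hw hξ hU t).fst

lemma measurable_chainY (hw : Measurable w) (hξ : ∀ t, Measurable (ξ t))
    (hU : ∀ t, Measurable (U t)) (t : ℕ) :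
    Measurable fun ω => chainY w (fun t => ξ t ω) (fun t => U t ω) t :=
  (measurable_laggedPair hw hξ hU t).snd

lemma measurableSet_forall_not_accepts (hw : Measurable w) (hξ : ∀ t, Measurable (ξ t))
    (hU : ∀ t, Measurable (U t)) (t : ℕ) :
    MeasurableSet {ω | ∀ k < t, ¬ Accepts w (fun t => ξ t ω) (fun t => U t ω) k} := by
  simp only [Set.ofPred_forall]
  refine .iInter fun k => .iInter fun _ => (measurableSet_lt (hU k) ?_).compl
  exact ((measurable_Zhat hw).comp (hξ _)).div ((measurable_Zhat hw).comp (hξ _))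

end Measurability

/-! ### Discrete layer-cake formulas and an exponential bound. -/

lemma ENat_toENNReal_eq_tsum (n : ℕ∞) :
    (n : ℝ≥0∞) = ∑' t : ℕ, if (t : ℕ∞) < n then 1 else 0 := by
  induction n with
  | top => simp
  | coe n =>
    rw [tsum_eq_sum (s := Finset.range n) fun t ht => if_neg (by simpa using ht),
      Finset.sum_congr rfl fun t ht => if_pos (by simpa using ht)]
    simp

lemma rpow_le_sum_range {s : ℝ} (hs : 1 ≤ s) (n : ℕ) :
    (n : ℝ) ^ s ≤ ∑ t ∈ Finset.range n, s * ((t : ℝ) + 1) ^ (s - 1) := by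
  induction n with
  | zero => simp [Real.zero_rpow (by linarith : s ≠ 0)]
  | succ n ih =>
    rw [Finset.sum_range_succ]
    have hn : (0 : ℝ) < (n : ℝ) + 1 := by positivity
    -- Bernoulli's inequality at -1/(n+1), rescaled by (n+1)^s, bounds the increment (n+1)^s - n^s
    -- by s(n+1)^{s-1}.
    have h1 : 1 + s * (-1 / ((n : ℝ) + 1)) ≤ (1 + -1 / ((n : ℝ) + 1)) ^ s :=
      one_add_mul_self_le_rpow_one_add (by rw [le_div_iff₀ hn]; linarith) hs
    have h2 : 1 + -1 / ((n : ℝ) + 1) = n / (n + 1) := by field_simp; ring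
    rw [h2, Real.div_rpow (by positivity) hn.le, le_div_iff₀ (by positivity)] at h1
    have h3 : ((n : ℝ) + 1) ^ s = ((n : ℝ) + 1) ^ (s - 1) * (n + 1) := by
      rw [Real.rpow_sub_one hn.ne']; field_simp
    have h4 : (1 + s * (-1 / ((n : ℝ) + 1))) * ((n : ℝ) + 1) ^ s
        = ((n : ℝ) + 1) ^ s - s * ((n : ℝ) + 1) ^ (s - 1) := by
      rw [h3]; field_simp; ring
    push_cast
    linarith

lemma ENat_rpow_le_tsum {s : ℝ} (hs : 1 ≤ s) (n : ℕ∞) :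
    (n : ℝ≥0∞) ^ s ≤
      ∑' t : ℕ, if (t : ℕ∞) < n then ENNReal.ofReal (s * ((t : ℝ) + 1) ^ (s - 1)) else 0 := by
  induction n with
  | top =>
    refine le_of_le_of_eq le_top (Eq.symm ?_)
    simp only [ENat.natCast_lt_top, if_true]
    -- Since s ≥ 1 every summand is at least 1, so the series diverges.
    refine top_unique ((ENNReal.tsum_const_eq_top_of_ne_zero (α := ℕ) one_ne_zero).symm.le.trans
      (ENNReal.tsum_le_tsum fun t => ?_))
    rw [← ENNReal.ofReal_one]
    refine ENNReal.ofReal_le_ofReal ?_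
    have : 1 ≤ ((t : ℝ) + 1) ^ (s - 1) := Real.one_le_rpow (by simp) (by linarith)
    nlinarith
  | coe n =>
    rw [tsum_eq_sum (s := Finset.range n) fun t ht => if_neg (by simpa using ht),
      Finset.sum_congr rfl fun t ht => if_pos (by simpa using ht),
      ← ENNReal.ofReal_sum_of_nonneg fun t _ => by positivity, ENat.toENNReal_coe,
      ← ENNReal.ofReal_natCast, ENNReal.ofReal_rpow_of_nonneg (by positivity) (by linarith)]
    exact ENNReal.ofReal_le_ofReal (rpow_le_sum_range hs n)

/-- The p-th power of y/p ≤ exp(y/p), inverted. -/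
lemma exp_neg_le_rpow {p y : ℝ} (hp : 0 < p) (hy : 0 < y) :
    Real.exp (-y) ≤ (p / y) ^ p := by
  have h : y / p ≤ Real.exp (y / p) := (le_add_of_nonneg_right zero_le_one).trans
    (Real.add_one_le_exp _)
  have h1 := Real.rpow_le_rpow (by positivity) h hp.le
  rw [← Real.exp_mul, div_mul_cancel₀ _ hp.ne'] at h1
  rw [Real.exp_neg, ← inv_div y p, Real.inv_rpow (by positivity)]
  exact inv_anti₀ (by positivity) h1

/-! ### Exact formula for the probability that the first `t` proposals are rejected. -/

lemma volume_restrict_Ioo_Ici (r : ℝ) (hr : 0 ≤ r) :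
    (volume.restrict (Set.Ioo (0 : ℝ) 1)) (Set.Ici r) = ENNReal.ofReal (1 - r) := by
  rw [restrict_Ioo_eq_restrict_Icc, Measure.restrict_apply measurableSet_Ici,
    show Set.Ici r ∩ Set.Icc 0 1 = Set.Icc r 1 by ext; simp; grind, Real.volume_Icc]

section Tail

variable {E Ω : Type*} [MeasurableSpace E] [MeasurableSpace Ω] {μ : Measure E}
  {P : Measure Ω} {ξ : ℕ → Ω → E} {U : ℕ → Ω → ℝ}

lemma measure_forall_le_unif (hU : ∀ t, Measurable (U t))
    (hlaw : ∀ t, P.map (U t) = volume.restrict (Set.Ioo (0 : ℝ) 1)) (hind : iIndepFun U P)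
    (r : ℕ → ℝ) (hr : ∀ k, 0 ≤ r k) (t : ℕ) :
    P {ω | ∀ k < t, r k ≤ U k ω} = ∏ k ∈ Finset.range t, ENNReal.ofReal (1 - r k) := by
  have h := hind.measure_inter_preimage_eq_mul (Finset.range t) (sets := fun k => Set.Ici (r k))
    fun k _ => measurableSet_Ici
  calc P {ω | ∀ k < t, r k ≤ U k ω} = P (⋂ k ∈ Finset.range t, U k ⁻¹' Set.Ici (r k)) := by
        congr 1; ext; simp
    _ = _ := by
        rw [h]
        refine Finset.prod_congr rfl fun k _ => ?_
        rw [← volume_restrict_Ioo_Ici _ (hr k), ← hlaw k, Measure.map_apply (hU k) measurableSet_Ici]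

/-- With `ξ 0` frozen, by independence from the block of later draws, the `t` factors are i.i.d. and
their product integrates to a `t`-th power. -/
lemma lintegral_prod_pair [IsProbabilityMeasure P] (hξ : ∀ t, Measurable (ξ t)) (hlaw : ∀ t, P.map (ξ t) = μ)
    (hind : iIndepFun ξ P) {g : E → E → ℝ≥0∞} (hg : Measurable (Function.uncurry g)) (t : ℕ) :
    ∫⁻ ω, ∏ k ∈ Finset.range t, g (ξ 0 ω) (ξ (k + 1) ω) ∂P =
      ∫⁻ x, (∫⁻ y, g x y ∂μ) ^ t ∂μ := by
  have : IsProbabilityMeasure μ := hlaw 0 ▸ Measure.isProbabilityMeasure_map (hξ 0).aemeasurable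
  let V : Ω → Fin t → E := fun ω k => ξ (k + 1) ω
  have hV : Measurable V := measurable_pi_lambda _ fun k => hξ _
  have hi : IndepFun (ξ 0) V P := by
    have h := hind.indepFun_finset {0} (Finset.Icc 1 t) (by simp) hξ
    have hφ : Measurable fun a : ({0} : Finset ℕ) → E => a ⟨0, by simp⟩ := measurable_pi_apply _
    have hψ : Measurable fun (a : Finset.Icc 1 t → E) (k : Fin t) =>
        a ⟨k + 1, Finset.mem_Icc.2 (by omega)⟩ :=
      measurable_pi_lambda _ fun k => measurable_pi_apply _
    exact h.comp hφ hψ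
  have hm : Measurable fun z : E × (Fin t → E) => ∏ k, g z.1 (z.2 k) :=
    Finset.measurable_prod _ fun k _ =>
      hg.comp (measurable_fst.prodMk ((measurable_pi_apply k).comp measurable_snd))
  calc ∫⁻ ω, ∏ k ∈ Finset.range t, g (ξ 0 ω) (ξ (k + 1) ω) ∂P
      = ∫⁻ ω, ∏ k : Fin t, g (ξ 0 ω) (V ω k) ∂P := by
        refine lintegral_congr fun ω => ?_
        exact (Fin.prod_univ_eq_prod_range (fun k => g (ξ 0 ω) (ξ (k + 1) ω)) t).symm
    _ = ∫⁻ z, ∏ k, g z.1 (z.2 k) ∂(P.map fun ω => (ξ 0 ω, V ω)) :=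
        (lintegral_map hm ((hξ 0).prodMk hV)).symm
    _ = ∫⁻ x, ∫⁻ v, ∏ k, g x (v k) ∂(P.map V) ∂μ := by
        have := Measure.isProbabilityMeasure_map (μ := P) hV.aemeasurable
        rw [(indepFun_iff_map_prod_eq_prod_map_map (hξ 0).aemeasurable hV.aemeasurable).1 hi,
          hlaw, lintegral_prod _ hm.aemeasurable]
    _ = _ := by
        refine lintegral_congr fun x => ?_
        have hgx : Measurable (g x) := hg.comp measurable_prodMk_left
        have hmx : Measurable fun v : Fin t → E => ∏ k, g x (v k) :=
          hm.comp measurable_prodMk_left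
        rw [lintegral_map hmx hV]
        have hind' : iIndepFun (fun (k : Fin t) ω => g x (ξ (k + 1) ω)) P :=
          (hind.precomp (g := fun k : Fin t => (k : ℕ) + 1) fun a b h => by
            simpa [Fin.ext_iff] using h).comp (fun _ => g x) fun _ => hgx
        rw [lintegral_prod_eq_prod_lintegral_of_indepFun _ _ hind' fun k => hgx.comp (hξ _)]
        simp_rw [← hlaw 0, ← lintegral_map hgx (hξ _), hlaw]
        simp

/-- Fubini: for fixed draws the uniforms contribute a product of factors 1 - r, truncated at 0 by
`ENNReal.ofReal`; that product is then integrated over the draws. -/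
lemma measure_forall_reject [IsProbabilityMeasure P] (hξ : ∀ t, Measurable (ξ t)) (hU : ∀ t, Measurable (U t))
    (hlaw : ∀ t, P.map (ξ t) = μ)
    (hlawU : ∀ t, P.map (U t) = volume.restrict (Set.Ioo (0 : ℝ) 1))
    (hind : iIndepFun ξ P) (hindU : iIndepFun U P)
    (hindξU : IndepFun (fun ω t => ξ t ω) (fun ω t => U t ω) P)
    {r : E → E → ℝ} (hr : Measurable (Function.uncurry r)) (hr0 : ∀ x y, 0 ≤ r x y) (t : ℕ) :
    P {ω | ∀ k < t, r (ξ 0 ω) (ξ (k + 1) ω) ≤ U k ω} =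
      ∫⁻ x, (∫⁻ y, ENNReal.ofReal (1 - r x y) ∂μ) ^ t ∂μ := by
  have hξ' : Measurable fun ω t => ξ t ω := measurable_pi_lambda _ hξ
  have hU' : Measurable fun ω t => U t ω := measurable_pi_lambda _ hU
  let S : Set ((ℕ → E) × (ℕ → ℝ)) := {z | ∀ k < t, r (z.1 0) (z.1 (k + 1)) ≤ z.2 k}
  have hS : MeasurableSet S := by
    simp only [S, Set.ofPred_forall]
    refine .iInter fun k => .iInter fun _ => measurableSet_le ?_ (by fun_prop)
    exact hr.comp (g := Function.uncurry r)
      (f := fun z : (ℕ → E) × (ℕ → ℝ) => (z.1 0, z.1 (k + 1))) (by fun_prop)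
  have := Measure.isProbabilityMeasure_map (μ := P) hU'.aemeasurable
  rw [← lintegral_prod_pair hξ hlaw hind (g := fun x y => ENNReal.ofReal (1 - r x y))
    (Measurable.ennreal_ofReal (f := fun z => 1 - Function.uncurry r z) (hr.const_sub 1))]
  calc P {ω | ∀ k < t, r (ξ 0 ω) (ξ (k + 1) ω) ≤ U k ω}
      = (P.map fun ω => ((fun t => ξ t ω), fun t => U t ω)) S :=
        (Measure.map_apply (hξ'.prodMk hU') hS).symm
    _ = ∫⁻ a, (P.map fun ω t => U t ω) (Prod.mk a ⁻¹' S) ∂(P.map fun ω t => ξ t ω) := by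
        have := Measure.isProbabilityMeasure_map (μ := P) hξ'.aemeasurable
        rw [(indepFun_iff_map_prod_eq_prod_map_map hξ'.aemeasurable hU'.aemeasurable).1 hindξU,
          Measure.prod_apply hS]
    _ = ∫⁻ ω, (P.map fun ω t => U t ω) (Prod.mk (fun t => ξ t ω) ⁻¹' S) ∂P :=
        lintegral_map (measurable_measure_prodMk_left hS) hξ'
    _ = _ := by
        refine lintegral_congr fun ω => ?_
        rw [Measure.map_apply hU' (measurable_prodMk_left hS)]
        exact measure_forall_le_unif hU hlawU hindU (fun k => r (ξ 0 ω) (ξ (k + 1) ω))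
          (fun k => hr0 _ _) t

end Tail

/-! ### Polynomial decay of the rejection tail. -/

/-- The rejection probability from a state of weight `z` is at most `exp (-c / max 1 z)`. -/
lemma exists_lintegral_reject_le {E : Type*} [MeasurableSpace E] {μ : Measure E}
    [IsProbabilityMeasure μ] {Z : E → ℝ} (hZ : Measurable Z) (hpos : ∀ᵐ x ∂μ, 0 < Z x) :
    ∃ c : ℝ, 0 < c ∧ ∀ z : ℝ, 0 < z →
      ∫⁻ y, ENNReal.ofReal (1 - |Z y / z|) ∂μ ≤ ENNReal.ofReal (Real.exp (-(c / max 1 z))) := by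
  have hint : Integrable (fun y => min 1 (Z y)) μ := by
    refine Integrable.of_bound (by fun_prop) 1 ?_
    filter_upwards [hpos] with y hy
    rw [Real.norm_of_nonneg (le_min zero_le_one hy.le)]
    exact min_le_left _ _
  -- Truncating at 1 makes the witness c = ∫ min(1, Z) finite without any moment of `Z`.
  refine ⟨∫ y, min 1 (Z y) ∂μ, ?_, fun z hz => ?_⟩
  · refine (integral_pos_iff_support_of_nonneg_ae ?_ hint).2 ?_
    · filter_upwards [hpos] with y hy using le_min zero_le_one hy.le
    · rw [pos_iff_ne_zero]
      intro h
      have : ∀ᵐ y ∂μ, False := by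
        filter_upwards [hpos, measure_eq_zero_iff_ae_notMem.1 h] with y hy h'
        exact h' (lt_min one_pos hy).ne'
      exact IsProbabilityMeasure.ne_zero μ (by simpa using this)
  · set m := max 1 z
    have hm : 0 < m := lt_max_of_lt_left one_pos
    have hint' : Integrable (fun y => 1 - min 1 (Z y) / m) μ :=
      (integrable_const _).sub (hint.div_const m)
    calc ∫⁻ y, ENNReal.ofReal (1 - |Z y / z|) ∂μ
        ≤ ∫⁻ y, ENNReal.ofReal (1 - min 1 (Z y) / m) ∂μ := by
          refine lintegral_mono_ae ?_
          filter_upwards [hpos] with y hy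
          rw [abs_of_pos (div_pos hy hz)]
          rcases le_total 1 (Z y / z) with h | h
          · rw [ENNReal.ofReal_of_nonpos (by linarith)]; exact zero_le
          · refine ENNReal.ofReal_le_ofReal (sub_le_sub_left ?_ 1)
            rcases le_total 1 z with h1 | h1
            · rw [show m = z from max_eq_right h1]
              gcongr; exact min_le_right _ _
            · rw [show m = 1 from max_eq_left h1, div_one]
              exact (min_le_right _ _).trans (by rw [le_div_iff₀ hz]; nlinarith)
      _ = ENNReal.ofReal (∫ y, (1 - min 1 (Z y) / m) ∂μ) := by
          refine (ofReal_integral_eq_lintegral_ofReal hint' ?_).symm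
          filter_upwards with y
          exact sub_nonneg.2 ((div_le_one hm).2 ((min_le_left _ _).trans (le_max_left _ _)))
      _ ≤ _ := by
          refine ENNReal.ofReal_le_ofReal ?_
          rw [integral_sub (integrable_const _) (hint.div_const m), integral_div]
          simp only [integral_const, probReal_univ, smul_eq_mul, mul_one]
          linarith [Real.add_one_le_exp (-((∫ y, min 1 (Z y) ∂μ) / m))]

/-- If `Z` has a finite `p`-th moment, the tail of the first acceptance time is `O(t ^ (-p))`. -/
lemma exists_lintegral_reject_pow_le {E : Type*} [MeasurableSpace E] {μ : Measure E}
    [IsProbabilityMeasure μ] {Z : E → ℝ} (hZ : Measurable Z) (hpos : ∀ᵐ x ∂μ, 0 < Z x)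
    {p : ℝ} (hp : 0 < p) (hmoment : ∫⁻ x, ENNReal.ofReal (Z x) ^ p ∂μ < ∞) :
    ∃ C : ℝ≥0∞, C ≠ ∞ ∧ ∀ t : ℕ,
      ∫⁻ x, (∫⁻ y, ENNReal.ofReal (1 - |Z y / Z x|) ∂μ) ^ (t + 1) ∂μ ≤
        C * ENNReal.ofReal (((t : ℝ) + 1) ^ (-p)) := by
  obtain ⟨c, hc, h⟩ := exists_lintegral_reject_le hZ hpos
  -- With m = max(1, Z), the constant comes from exp(-(t+1)c/m) ≤ (pm/((t+1)c))^p and m^p ≤ 1 + Z^p.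
  refine ⟨ENNReal.ofReal ((p / c) ^ p) * (1 + ∫⁻ x, ENNReal.ofReal (Z x) ^ p ∂μ),
    ENNReal.mul_ne_top ENNReal.ofReal_ne_top (ENNReal.add_ne_top.2 ⟨ENNReal.one_ne_top, hmoment.ne⟩),
    fun t => ?_⟩
  have ht : (0 : ℝ) < (t : ℝ) + 1 := by positivity
  calc ∫⁻ x, (∫⁻ y, ENNReal.ofReal (1 - |Z y / Z x|) ∂μ) ^ (t + 1) ∂μ
      ≤ ∫⁻ x, ENNReal.ofReal ((p / c) ^ p) * ENNReal.ofReal (((t : ℝ) + 1) ^ (-p)) *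
          (1 + ENNReal.ofReal (Z x) ^ p) ∂μ := by
        refine lintegral_mono_ae ?_
        filter_upwards [hpos] with x hx
        set m := max 1 (Z x)
        have hm : 0 < m := lt_max_of_lt_left one_pos
        have hmp : m ^ p ≤ 1 + Z x ^ p := by
          rcases max_cases 1 (Z x) with ⟨h, -⟩ | ⟨h, -⟩
          · rw [show m = 1 from h, Real.one_rpow]
            exact le_add_of_nonneg_right (by positivity)
          · rw [show m = Z x from h]; linarith
        rw [ENNReal.ofReal_rpow_of_pos hx, ← ENNReal.ofReal_one,
          ← ENNReal.ofReal_add (by positivity) (by positivity),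
          ← ENNReal.ofReal_mul (by positivity), ← ENNReal.ofReal_mul (by positivity)]
        calc _ ≤ ENNReal.ofReal (Real.exp (-(c / m))) ^ (t + 1) := by
              gcongr; simpa using h (Z x) hx
          _ = ENNReal.ofReal (Real.exp (-(((t : ℝ) + 1) * (c / m)))) := by
              rw [← ENNReal.ofReal_pow (by positivity), ← Real.exp_nat_mul]
              push_cast; ring_nf
          _ ≤ _ := by
              refine ENNReal.ofReal_le_ofReal ((exp_neg_le_rpow hp (by positivity)).trans ?_)
              rw [show p / (((t : ℝ) + 1) * (c / m)) = p / c * ((t : ℝ) + 1)⁻¹ * m by field_simp,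
                Real.mul_rpow (by positivity) hm.le, Real.mul_rpow (by positivity) (by positivity),
                Real.inv_rpow ht.le, ← Real.rpow_neg ht.le]
              gcongr
    _ = _ := by
        rw [lintegral_const_mul _ (by fun_prop), lintegral_add_left measurable_const]
        simp only [lintegral_const, measure_univ, mul_one]
        ring

/-! ### Transfer from `q` to the product measure. -/

section Moments

variable {X : Type*} [MeasurableSpace X] {q : Measure X} [IsProbabilityMeasure q] {w : X → ℝ}
  {N : ℕ}

lemma ae_pi_forall_coord {p : X → Prop} (h : ∀ᵐ x ∂q, p x) :
    ∀ᵐ x ∂(Measure.pi fun _ : Fin N => q), ∀ n, p (x n) :=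
  ae_all_iff.2 fun n =>
    (measurePreserving_eval (fun _ : Fin N => q) n).quasiMeasurePreserving.ae h

lemma ae_Zhat_pos (hN : 1 ≤ N) (hw_pos : ∀ᵐ x ∂q, 0 < w x) :
    ∀ᵐ x ∂(Measure.pi fun _ : Fin N => q), 0 < Zhat w x := by
  filter_upwards [ae_pi_forall_coord hw_pos] with x hx using Zhat_pos hN hx

/-- Passing to `MemLp` lets the moment of the average `Zhat` follow from closure of L^p under sums
and scalars. -/
lemma memLp_of_lintegral_ofReal_rpow {α : Type*} [MeasurableSpace α] {μ : Measure α} {g : α → ℝ}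
    {p : ℝ} (hp : 0 < p) (hg : Measurable g) (hpos : ∀ᵐ x ∂μ, 0 < g x) :
    MemLp g (ENNReal.ofReal p) μ ↔ ∫⁻ x, ENNReal.ofReal (g x) ^ p ∂μ < ∞ := by
  have h : ∫⁻ x, ‖g x‖ₑ ^ p ∂μ = ∫⁻ x, ENNReal.ofReal (g x) ^ p ∂μ := by
    refine lintegral_congr_ae ?_
    filter_upwards [hpos] with x hx
    rw [Real.enorm_of_nonneg hx.le]
  rw [MemLp, and_iff_right hg.aestronglyMeasurable,
    eLpNorm_lt_top_iff_lintegral_rpow_enorm_lt_top (by simpa using hp) ENNReal.ofReal_ne_top,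
    ENNReal.toReal_ofReal hp.le, h]

lemma lintegral_Zhat_rpow_lt_top (hN : 1 ≤ N) (hw : Measurable w) (hw_pos : ∀ᵐ x ∂q, 0 < w x)
    {p : ℝ} (hp : 0 < p) (hmoment : ∫⁻ x, ENNReal.ofReal (w x) ^ p ∂q < ∞) :
    ∫⁻ x, ENNReal.ofReal (Zhat w x) ^ p ∂(Measure.pi fun _ : Fin N => q) < ∞ := by
  rw [← memLp_of_lintegral_ofReal_rpow hp hw hw_pos] at hmoment
  rw [← memLp_of_lintegral_ofReal_rpow hp (measurable_Zhat hw) (ae_Zhat_pos hN hw_pos)]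
  exact (memLp_finsetSum Finset.univ fun n _ =>
    hmoment.comp_measurePreserving (measurePreserving_eval (fun _ : Fin N => q) n)).const_mul _

end Moments

/-! ### Law and moments of the meeting time. -/

namespace IsInput

variable {X Ω : Type*} [MeasurableSpace X] [MeasurableSpace Ω] {q : Measure X}
  {P : Measure Ω} {N : ℕ} {ξ : ℕ → Ω → Fin N → X} {U : ℕ → Ω → ℝ}

lemma ae_draw [IsProbabilityMeasure q] (h : IsInput q P ξ U) {p : X → Prop} (hp : ∀ᵐ x ∂q, p x) :
    ∀ᵐ ω ∂P, ∀ t n, p (ξ t ω n) := by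
  refine ae_all_iff.2 fun t => ae_of_ae_map (p := fun x => ∀ n, p (x n))
    (h.measurable_draw t).aemeasurable ?_
  rw [h.law_draw]
  exact ae_pi_forall_coord hp

lemma ae_unif (h : IsInput q P ξ U) : ∀ᵐ ω ∂P, ∀ t, U t ω < 1 := by
  refine ae_all_iff.2 fun t => ae_of_ae_map (p := fun x => x < 1)
    (h.measurable_unif t).aemeasurable ?_
  rw [h.law_unif]
  filter_upwards [ae_restrict_mem measurableSet_Ioo] with x hx using hx.2

variable {w : X → ℝ}

lemma ae_lt_meetingTime_iff [IsProbabilityMeasure q] (h : IsInput q P ξ U) (hN : 1 ≤ N) (hw_pos : ∀ᵐ x ∂q, 0 < w x) :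
    ∀ᵐ ω ∂P, ∀ t : ℕ, (t : ℕ∞) < meetingTime w (fun t => ξ t ω) (fun t => U t ω) ↔
      ∀ k < t, ¬ Accepts w (fun t => ξ t ω) (fun t => U t ω) k := by
  filter_upwards [h.ae_draw hw_pos, h.ae_unif] with ω h1 h2
  exact lt_meetingTime_iff (fun t => Zhat_pos hN (h1 t)) h2

lemma aemeasurable_meetingTime [IsProbabilityMeasure q] (h : IsInput q P ξ U) (hN : 1 ≤ N) (hw : Measurable w)
    (hw_pos : ∀ᵐ x ∂q, 0 < w x) :
    AEMeasurable
      (fun ω => (meetingTime w (fun t => ξ t ω) (fun t => U t ω) : ℝ≥0∞)) P := by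
  classical
  refine ⟨fun ω => ∑' t : ℕ,
    if ∀ k < t, ¬ Accepts w (fun t => ξ t ω) (fun t => U t ω) k then 1 else 0,
    Measurable.tsum fun t => Measurable.ite (measurableSet_forall_not_accepts hw
      h.measurable_draw h.measurable_unif t) measurable_const measurable_const, ?_⟩
  filter_upwards [h.ae_lt_meetingTime_iff hN hw_pos] with ω hω
  rw [ENat_toENNReal_eq_tsum]
  simp only [hω]

lemma exists_measure_forall_not_accepts_le [IsProbabilityMeasure q] [IsProbabilityMeasure P]
    (h : IsInput q P ξ U)
    (hN : 1 ≤ N) (hw : Measurable w) (hw_pos : ∀ᵐ x ∂q, 0 < w x) {p : ℝ} (hp : 0 < p)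
    (hmoment : ∫⁻ x, ENNReal.ofReal (w x) ^ p ∂q < ∞) :
    ∃ C : ℝ≥0∞, C ≠ ∞ ∧ ∀ t : ℕ,
      P {ω | ∀ k < t + 1, ¬ Accepts w (fun t => ξ t ω) (fun t => U t ω) k} ≤
        C * ENNReal.ofReal (((t : ℝ) + 1) ^ (-p)) := by
  have hZ : Measurable (Zhat w : (Fin N → X) → ℝ) := measurable_Zhat hw
  obtain ⟨C, hC, hle⟩ := exists_lintegral_reject_pow_le hZ (ae_Zhat_pos hN hw_pos) hp
    (lintegral_Zhat_rpow_lt_top hN hw hw_pos hp hmoment)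
  refine ⟨C, hC, fun t => le_trans (le_of_eq ?_) (hle t)⟩
  -- The absolute value makes the ratio nonnegative everywhere; almost surely it changes nothing.
  rw [← measure_forall_reject (r := fun x y => |Zhat w y / Zhat w x|) h.measurable_draw
    h.measurable_unif h.law_draw h.law_unif h.indep_draw h.indep_unif h.indep_draw_unif
    ((hZ.comp measurable_snd).div (hZ.comp measurable_fst)).abs (fun _ _ => abs_nonneg _)]
  refine measure_congr ?_
  filter_upwards [h.ae_draw hw_pos] with ω hω
  have hpos (t : ℕ) : 0 < Zhat w (ξ t ω) := Zhat_pos hN (hω t)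
  refine propext (forall₂_congr fun k _ => ?_)
  rw [Accepts, not_lt, abs_of_pos (div_pos (hpos _) (hpos _))]

lemma lintegral_meetingTime_rpow_lt_top [IsProbabilityMeasure q] [IsProbabilityMeasure P]
    (h : IsInput q P ξ U)
    (hN : 1 ≤ N) (hw : Measurable w) (hw_pos : ∀ᵐ x ∂q, 0 < w x) {p s : ℝ} (hs : 1 ≤ s)
    (hsp : s < p) (hmoment : ∫⁻ x, ENNReal.ofReal (w x) ^ p ∂q < ∞) :
    ∫⁻ ω, (meetingTime w (fun t => ξ t ω) (fun t => U t ω) : ℝ≥0∞) ^ s ∂P < ∞ := by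
  classical
  obtain ⟨C, hC, hle⟩ := h.exists_measure_forall_not_accepts_le hN hw hw_pos (by linarith) hmoment
  let B (t : ℕ) : Set Ω := {ω | ∀ k < t, ¬ Accepts w (fun t => ξ t ω) (fun t => U t ω) k}
  have hB (t : ℕ) : MeasurableSet (B t) :=
    measurableSet_forall_not_accepts hw h.measurable_draw h.measurable_unif t
  let b (t : ℕ) : ℝ := s * ((t : ℝ) + 1) ^ (s - 1)
  -- From t+2 ≤ 2(t+1), (t+2)^{s-1}(t+1)^{-p} ≤ 2^{s-1}(t+1)^{-(p-s+1)}, and p-s+1 > 1.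
  have hsum : Summable fun t : ℕ => s * 2 ^ (s - 1) * ((t : ℝ) + 1) ^ (-(p - s + 1)) := by
    refine Summable.mul_left _ ?_
    have := (summable_nat_add_iff 1).2 (Real.summable_nat_rpow.2 (by linarith : -(p - s + 1) < -1))
    simpa using this
  have hterm (t : ℕ) : ENNReal.ofReal (b (t + 1)) * P (B (t + 1)) ≤
      C * ENNReal.ofReal (s * 2 ^ (s - 1) * ((t : ℝ) + 1) ^ (-(p - s + 1))) := by
    have ht : (0 : ℝ) < (t : ℝ) + 1 := by positivity
    calc _ ≤ ENNReal.ofReal (b (t + 1)) * (C * ENNReal.ofReal (((t : ℝ) + 1) ^ (-p))) := by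
          gcongr; exact hle t
      _ = C * ENNReal.ofReal (b (t + 1) * ((t : ℝ) + 1) ^ (-p)) := by
          rw [ENNReal.ofReal_mul (p := b (t + 1)) (by positivity), mul_left_comm]
      _ ≤ _ := by
          refine mul_le_mul_right (ENNReal.ofReal_le_ofReal ?_) C
          simp only [b]
          rw [show -(p - s + 1) = (s - 1) + -p by ring, Real.rpow_add ht, ← mul_assoc,
            mul_assoc s (2 ^ (s - 1)), ← Real.mul_rpow zero_le_two ht.le]
          gcongr
          · push_cast; linarith
  calc ∫⁻ ω, (meetingTime w (fun t => ξ t ω) (fun t => U t ω) : ℝ≥0∞) ^ s ∂P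
      ≤ ∫⁻ ω, ∑' t : ℕ, (B t).indicator (fun _ => ENNReal.ofReal (b t)) ω ∂P := by
        refine lintegral_mono_ae ?_
        filter_upwards [h.ae_lt_meetingTime_iff hN hw_pos] with ω hω
        refine (ENat_rpow_le_tsum hs _).trans_eq (tsum_congr fun t => ?_)
        simp only [hω, Set.indicator_apply, B, b, Set.mem_ofPred_eq]
    _ = ∑' t : ℕ, ENNReal.ofReal (b t) * P (B t) := by
        rw [lintegral_tsum fun t => (measurable_const.indicator (hB t)).aemeasurable]
        exact tsum_congr fun t => lintegral_indicator_const (hB t) _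
    -- The tail bound needs at least one rejection, so t = 0 is split off.
    _ = ENNReal.ofReal (b 0) * P (B 0) + ∑' t : ℕ, ENNReal.ofReal (b (t + 1)) * P (B (t + 1)) :=
        tsum_eq_zero_add' ENNReal.summable
    _ ≤ ENNReal.ofReal (b 0) * P (B 0) +
          C * ∑' t : ℕ, ENNReal.ofReal (s * 2 ^ (s - 1) * ((t : ℝ) + 1) ^ (-(p - s + 1))) := by
        rw [← ENNReal.tsum_mul_left]
        exact add_le_add_right (ENNReal.tsum_le_tsum hterm) _
    _ < ∞ := ENNReal.add_lt_top.2 ⟨ENNReal.mul_lt_top ENNReal.ofReal_lt_top (measure_lt_top _ _),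
        ENNReal.mul_lt_top hC.lt_top hsum.tsum_ofReal_lt_top⟩

end IsInput

end PIMH

theorem mainTheorem9 {X : Type*} [MeasurableSpace X]
    (q π : Measure X) [IsProbabilityMeasure q] [IsProbabilityMeasure π]
    -- the target is absolutely continuous with respect to the proposal, and the weight `w` is
    -- a version of the Radon–Nikodym derivative which is positive almost surely
    (hac : π ≪ q)
    (w : X → ℝ) (hw : Measurable w)
    (hw_density : w =ᵐ[q] fun x => (π.rnDeriv q x).toReal)
    (hw_pos : ∀ᵐ x ∂q, 0 < w x)
    -- the test function
    (f : X → ℝ) (hf : Measurable f) (hf_bound : ∀ᵐ x ∂q, |f x| ≤ 1)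
    -- the moment condition
    (p s : ℝ) (hp : 2 ≤ p) (hs : 1 ≤ s) (hsp : s < p)
    (hmoment : ∫⁻ x, ENNReal.ofReal (w x) ^ p ∂q < ∞)
    -- the number of particles and the random draws of the algorithm
    (N : ℕ) (hN : 1 ≤ N)
    {Ω : Type*} [MeasurableSpace Ω] (P : Measure Ω) [IsProbabilityMeasure P]
    (ξ : ℕ → Ω → Fin N → X) (U : ℕ → Ω → ℝ) (hinput : PIMH.IsInput q P ξ U) :
    (AEMeasurable
        (fun ω => (PIMH.meetingTime w (fun t => ξ t ω) (fun t => U t ω) : ℝ≥0∞)) P ∧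
      ∫⁻ ω, (PIMH.meetingTime w (fun t => ξ t ω) (fun t => U t ω) : ℝ≥0∞) ^ s ∂P < ∞) ∧
    (AEStronglyMeasurable
        (fun ω => PIMH.unbiasedIS w f (fun t => ξ t ω) (fun t => U t ω)) P ∧
      ∫⁻ ω, ENNReal.ofReal
        |PIMH.unbiasedIS w f (fun t => ξ t ω) (fun t => U t ω)| ^ s ∂P < ∞) := by
  have hτm := hinput.aemeasurable_meetingTime hN hw hw_pos
  have hτs := hinput.lintegral_meetingTime_rpow_lt_top hN hw hw_pos hs hsp hmoment
  -- A finite s-th moment already forces almost sure meeting.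
  have hτ : ∀ᵐ ω ∂P, PIMH.meetingTime w (fun t => ξ t ω) (fun t => U t ω) ≠ ⊤ := by
    filter_upwards [ae_lt_top' (hτm.pow_const s) hτs.ne] with ω hω h
    rw [h, ENat.toENNReal_top, ENNReal.top_rpow_of_pos (by linarith)] at hω
    exact lt_irrefl _ hω
  refine ⟨⟨hτm, hτs⟩, ?_, ?_⟩
  · refine aestronglyMeasurable_of_tendsto_ae Filter.atTop
      (f := fun (m : ℕ) ω => PIMH.Fhat w f (ξ 0 ω) + ∑ t ∈ Finset.Ico 1 m,
        (PIMH.Fhat w f (PIMH.chainX w (fun t => ξ t ω) (fun t => U t ω) t) -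
          PIMH.Fhat w f (PIMH.chainY w (fun t => ξ t ω) (fun t => U t ω) (t - 1))))
      (fun m => ?_) ?_
    · have hF := PIMH.measurable_Fhat (N := N) hw hf
      have hξ := hinput.measurable_draw
      have hU := hinput.measurable_unif
      exact ((hF.comp (hξ 0)).add (Finset.measurable_fun_sum _ fun t _ =>
        (hF.comp (PIMH.measurable_chainX hw hξ hU t)).sub
          (hF.comp (PIMH.measurable_chainY hw hξ hU (t - 1))))).aestronglyMeasurable
    · filter_upwards [hτ, hinput.ae_draw hw_pos, hinput.ae_unif] with ω h1 h2 h3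
      exact PIMH.tendsto_unbiasedIS f (fun t => PIMH.Zhat_pos hN (h2 t)) h3 h1
  · refine (lintegral_mono_ae ?_).trans_lt (b := ∫⁻ ω, 2 ^ s *
      (PIMH.meetingTime w (fun t => ξ t ω) (fun t => U t ω) : ℝ≥0∞) ^ s ∂P) ?_
    · filter_upwards [hτ, hinput.ae_draw hw_pos, hinput.ae_draw hf_bound] with ω h1 h2 h3
      rw [← ENNReal.mul_rpow_of_nonneg _ _ (by linarith)]
      refine ENNReal.rpow_le_rpow ?_ (by linarith)
      refine (ENNReal.ofReal_le_ofReal (PIMH.abs_unbiasedIS_le h2 h3 h1)).trans_eq ?_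
      rw [ENNReal.ofReal_mul zero_le_two, ENNReal.ofReal_natCast, ENNReal.ofReal_ofNat]
      congr 1
      exact_mod_cast congrArg ENat.toENNReal (ENat.natCast_toNat h1)
    · rw [lintegral_const_mul' _ _ (ENNReal.rpow_ne_top_of_nonneg (by linarith) ENNReal.ofNat_ne_top)]
      exact ENNReal.mul_lt_top
        (ENNReal.rpow_lt_top_of_nonneg (by linarith) ENNReal.ofNat_ne_top) hτs
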